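/- All rings are commutative with identity. A normal domain is a noetherian integrally closed integral domain. A module $C$ over a noetherian ring $R$ is semidualizing if it is finitely generated, $\operatorname{Hom}_R(C,C)\cong R$, and $\operatorname{Ext}^n_R(C,C)=0$ for all $n\geq 1$. For a normal domain $A$, the divisor class group $\operatorname{Cl}(A)$ is the set of isomorphism classes of finitely generated reflexive $A$-modules of rank $1$, with the operation $[\mathfrak a]+[\mathfrak b]=[(\mathfrak a\otimes_A\mathfrak b)^{**}]$, where $(-)^*=\operatorname{Hom}_A(-,A)$. Let $D$ be a principal ideal domain (possibly a field), let $R_1$ and $R_2$ be normal domains equipped with injective ring homomorphisms $D\to R_1$ and $D\to R_2$, and assume that $T=R_1\otimes_D R_2$ is a normal domain. **Lemma.** For $i=1,2$ let $\mathfrak a_i$ be a finitely generated reflexive $R_i$-module of rank $1$, so that $[\mathfrak a_i]\in\operatorname{Cl}(R_i)$. Suppose that $D$ is a field, or that $\mathfrak a_i$ is a semidualizing $R_i$-module for both $i=1,2$. Then $\mathfrak a_1\otimes_D\mathfrak a_2$ is a reflexive $T$-module; moreover $\mathfrak a_1\otimes_D\mathfrak a_2$, $\mathfrak a_1\otimes_{R_1}T$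 and $T\otimes_{R_2}\mathfrak a_2$ are finitely generated reflexive $T$-modules of rank $1$, and in $\operatorname{Cl}(T)$ $$[\mathfrak a_1\otimes_D\mathfrak a_2]=[\mathfrak a_1\otimes_{R_1}T]+[T\otimes_{R_2}\mathfrak a_2].$$ -/

import Mathlib

open scoped TensorProduct

universe u

section ExternalTensor

variable {D R₁ R₂ : Type u} [CommRing D] [CommRing R₁] [CommRing R₂] [Algebra D R₁] [Algebra D R₂]
variable (M₁ M₂ : Type u) [AddCommGroup M₁] [AddCommGroup M₂]
variable [Module D M₁] [Module R₁ M₁] [IsScalarTower D R₁ M₁]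
variable [Module D M₂] [Module R₂ M₂] [IsScalarTower D R₂ M₂]

/-- The action of `R₁ ⊗[D] R₂` on `M₁ ⊗[D] M₂` by `D`-linear endomorphisms:
`r ⊗ s` acts as `(r • ·) ⊗ (s • ·)`. -/
noncomputable def externalTensorAction :
    (R₁ ⊗[D] R₂) →ₐ[D] Module.End D (M₁ ⊗[D] M₂) :=
  (Module.endTensorEndAlgHom (R := D) (S := D) (A := D) (M := M₁) (N := M₂)).comp
    (Algebra.TensorProduct.map (Algebra.lsmul D D M₁) (Algebra.lsmul D D M₂))

/-- If `M₁` is an `R₁`-module and `M₂` is an `R₂`-module, then `M₁ ⊗[D] M₂` is a module over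
`R₁ ⊗[D] R₂`, with `(r ⊗ s) • (m ⊗ n) = (r • m) ⊗ (s • n)`. -/
noncomputable instance (priority := 50) externalTensorModule : Module (R₁ ⊗[D] R₂) (M₁ ⊗[D] M₂) :=
  Module.compHom (M₁ ⊗[D] M₂)
    (externalTensorAction (D := D) (R₁ := R₁) (R₂ := R₂) M₁ M₂).toRingHom

variable {M₁ M₂}

theorem externalTensor_smul_tmul (r : R₁) (s : R₂) (m : M₁) (n : M₂) :
    (r ⊗ₜ[D] s : R₁ ⊗[D] R₂) • (m ⊗ₜ[D] n : M₁ ⊗[D] M₂) = (r • m) ⊗ₜ[D] (s • n) :=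
  rfl

end ExternalTensor

-- The `R₂`-algebra structure of `R₁ ⊗[D] R₂` given by `s ↦ 1 ⊗ s`. (The `R₁`-algebra structure
-- `r ↦ r ⊗ 1` is already a global instance.)
attribute [local instance] Algebra.TensorProduct.rightAlgebra

/-- Semidualizing modules over a (noetherian) ring: finitely generated modules `C` with
`Hom(C, C) ≅ R` and `Ext^n(C, C) = 0` for all `n ≥ 1`. -/
structure IsSemidualizing (R : Type u) [CommRing R] (C : Type u) [AddCommGroup C] [Module R C] :
    Prop where
  finite : Module.Finite R C
  hom_self : Nonempty ((C →ₗ[R] C) ≃ₗ[R] R)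
  ext_self : ∀ n : ℕ, 1 ≤ n →
    Subsingleton (CategoryTheory.Abelian.Ext (ModuleCat.of R C) (ModuleCat.of R C) n)

/-- Finitely generated reflexive modules of rank `1` over a domain: the modules whose isomorphism
classes are the elements of the divisor class group. -/
structure IsRankOneReflexive (A : Type u) [CommRing A] (M : Type u) [AddCommGroup M] [Module A M] :
    Prop where
  finite : Module.Finite A M
  reflexive : Module.IsReflexive A M
  rank_eq_one : Module.rank A M = 1

section RankOne

variable {A : Type u} [CommRing A]
variable {M N : Type u} [AddCommGroup M] [Module A M] [AddCommGroup N] [Module A N]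

/-- Auxiliary condition: every element of `M` is, up to a fixed nonzero scalar, a multiple of one
fixed element. -/
def IsRankOneAux (A M : Type u) [CommRing A] [AddCommGroup M] [Module A M] : Prop :=
  ∃ (g : Module.Dual A M) (m : M), g m ≠ 0 ∧ ∀ z : M, g m • z = g z • m

theorem IsRankOneAux.dual (h : IsRankOneAux A M) : IsRankOneAux A (Module.Dual A M) := by
  obtain ⟨g, m, h0, h⟩ := h
  refine ⟨Module.Dual.eval A M m, g, by simpa using h0, fun f => ?_⟩
  ext z
  have := congrArg f (h z)
  simp only [map_smul, smul_eq_mul] at this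
  simp only [Module.Dual.eval_apply, LinearMap.smul_apply, smul_eq_mul]
  rw [this, mul_comm]

theorem IsRankOneAux.tensor [IsDomain A] (hM : IsRankOneAux A M) (hN : IsRankOneAux A N) :
    IsRankOneAux A (M ⊗[A] N) := by
  obtain ⟨g, m, hg0, hg⟩ := hM
  obtain ⟨f, n, hf0, hf⟩ := hN
  refine ⟨TensorProduct.lift ((LinearMap.mul A A).compl₁₂ g f), m ⊗ₜ n, ?_, fun z => ?_⟩
  · simpa using ⟨hg0, hf0⟩
  · induction z with
    | zero => simp
    | add x y hx hy => rw [smul_add, hx, hy, map_add, add_smul]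
    | tmul x y =>
      simp only [TensorProduct.lift.tmul, LinearMap.compl₁₂_apply, LinearMap.mul_apply']
      rw [← TensorProduct.smul_tmul_smul, hg, hf, TensorProduct.smul_tmul_smul]

theorem IsRankOneAux.isReflexive_dual [IsDomain A] (h : IsRankOneAux A M) :
    Module.IsReflexive A (Module.Dual A M) := by
  obtain ⟨g, m, h0, h⟩ := h
  have key : ∀ (x : Module.Dual A (Module.Dual A M)) (f : Module.Dual A M),
      g m * x f = x g * f m := by
    intro x f
    have : g m • f = f m • g := by
      ext z
      have := congrArg f (h z)
      simp only [map_smul, smul_eq_mul] at this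
      simp only [LinearMap.smul_apply, smul_eq_mul]
      rw [this, mul_comm]
    have := congrArg x this
    simp only [map_smul, smul_eq_mul] at this
    rw [this, mul_comm]
  refine ⟨⟨fun f₁ f₂ hf => ?_, fun φ => ⟨φ ∘ₗ Module.Dual.eval A M, ?_⟩⟩⟩
  · ext z
    simpa using LinearMap.congr_fun hf (Module.Dual.eval A M z)
  · apply LinearMap.ext
    intro x
    refine mul_left_cancel₀ h0 ?_
    have hx : g m • x = x g • Module.Dual.eval A M m := by
      apply LinearMap.ext
      intro f
      simpa using key x f
    have := congrArg φ hx
    simp only [map_smul, smul_eq_mul] at this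
    rw [this, Module.Dual.eval_apply, key]
    rfl

theorem IsRankOneAux.isRankOneReflexive [IsDomain A] [IsNoetherianRing A]
    (h : IsRankOneAux A M) [hM : Module.IsReflexive A M] : IsRankOneReflexive A M := by
  obtain ⟨g, m, h0, h⟩ := h
  have hg : Function.Injective g := by
    rw [injective_iff_map_eq_zero]
    intro z hz
    have := h z
    rw [hz, zero_smul] at this
    exact (smul_eq_zero.mp this).resolve_left h0
  have : Nontrivial M := ⟨m, 0, fun hm => h0 (by simp [hm])⟩
  refine ⟨Module.Finite.of_injective g hg, hM, le_antisymm ?_ ?_⟩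
  · simpa using LinearMap.rank_le_of_injective g hg
  · exact Cardinal.one_le_iff_pos.mpr rank_pos

theorem IsRankOneReflexive.aux [IsDomain A] (h : IsRankOneReflexive A M) : IsRankOneAux A M := by
  have := h.reflexive
  have hnt : Nontrivial M := by
    by_contra hn
    rw [not_nontrivial_iff_subsingleton] at hn
    have h1 := h.rank_eq_one
    rw [rank_subsingleton'] at h1
    exact zero_ne_one h1
  obtain ⟨m, hm⟩ := exists_ne (0 : M)
  obtain ⟨g, hg⟩ : ∃ g : Module.Dual A M, g m ≠ 0 := by
    by_contra! hc
    refine hm ((Module.bijective_dual_eval A M).1 ?_)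
    ext f
    simp [hc f]
  refine ⟨g, m, hg, fun z => ?_⟩
  by_contra hne
  have hw : g m • z - g z • m ≠ 0 := sub_ne_zero.mpr hne
  have hgw : g (g m • z - g z • m) = 0 := by simp [mul_comm]
  have hli : LinearIndependent A ![m, g m • z - g z • m] := by
    rw [LinearIndependent.pair_iff]
    intro s t hst
    have hs : s = 0 := by
      have := congrArg g hst
      rw [map_add, map_smul, map_smul, hgw] at this
      simpa [hg] using this
    rw [hs, zero_smul, zero_add] at hst
    exact ⟨hs, (smul_eq_zero.mp hst).resolve_right hw⟩
  have := hli.cardinal_lift_le_rank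
  rw [h.rank_eq_one] at this
  simp at this

theorem IsRankOneReflexive.bidual_tensor [IsDomain A] [IsNoetherianRing A]
    (hM : IsRankOneReflexive A M) (hN : IsRankOneReflexive A N) :
    IsRankOneReflexive A (Module.Dual A (Module.Dual A (M ⊗[A] N))) := by
  have h := hM.aux.tensor hN.aux
  have := h.dual.isReflexive_dual
  exact h.dual.dual.isRankOneReflexive

end RankOne

/-- A finitely generated reflexive module of rank `1` over `A`. -/
structure RankOneReflexive (A : Type u) [CommRing A] where
  carrier : Type u
  [addCommGroup : AddCommGroup carrier]
  [module : Module A carrier]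
  prop : IsRankOneReflexive A carrier

attribute [instance] RankOneReflexive.addCommGroup RankOneReflexive.module

/-- The isomorphism relation between finitely generated reflexive modules of rank `1`. -/
instance RankOneReflexive.setoid (A : Type u) [CommRing A] : Setoid (RankOneReflexive A) where
  r M N := Nonempty (M.carrier ≃ₗ[A] N.carrier)
  iseqv := ⟨fun _ => ⟨LinearEquiv.refl _ _⟩, fun ⟨e⟩ => ⟨e.symm⟩, fun ⟨e⟩ ⟨f⟩ => ⟨e.trans f⟩⟩

/-- The divisor class group `Cl(A)` of a normal domain `A`, i.e. of a noetherian integrally closed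
domain: the set of isomorphism classes of finitely generated reflexive `A`-modules of rank `1`.
Its addition is defined below. -/
def DivisorClassGroup (A : Type u) [CommRing A] [IsDomain A] [IsNoetherianRing A]
    [IsIntegrallyClosed A] : Type (u + 1) :=
  Quotient (RankOneReflexive.setoid A)

namespace DivisorClassGroup

variable {A : Type u} [CommRing A] [IsDomain A] [IsNoetherianRing A] [IsIntegrallyClosed A]

/-- The class `[M]` in `Cl(A)` of a finitely generated reflexive module `M` of rank `1`. -/
def mk (M : Type u) [AddCommGroup M] [Module A M] (h : IsRankOneReflexive A M) :
    DivisorClassGroup A :=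
  Quotient.mk (RankOneReflexive.setoid A) ⟨M, h⟩

theorem mk_eq_mk_iff {M N : Type u} [AddCommGroup M] [Module A M] [AddCommGroup N] [Module A N]
    {hM : IsRankOneReflexive A M} {hN : IsRankOneReflexive A N} :
    mk M hM = mk N hN ↔ Nonempty (M ≃ₗ[A] N) :=
  Quotient.eq

/-- The addition of `Cl(A)`: `[M] + [N] = [(M ⊗ N)**]`, where `*` is the `A`-dual. -/
instance : Add (DivisorClassGroup A) where
  add := Quotient.map₂
    (fun M N => ⟨Module.Dual A (Module.Dual A (M.carrier ⊗[A] N.carrier)),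
      M.prop.bidual_tensor N.prop⟩)
    (by
      rintro M M' ⟨e⟩ N N' ⟨f⟩
      exact ⟨(TensorProduct.congr e f).symm.dualMap.symm.dualMap⟩)

theorem mk_add_mk {M N : Type u} [AddCommGroup M] [Module A M] [AddCommGroup N] [Module A N]
    (hM : IsRankOneReflexive A M) (hN : IsRankOneReflexive A N) :
    mk M hM + mk N hN =
      mk (Module.Dual A (Module.Dual A (M ⊗[A] N))) (hM.bidual_tensor hN) :=
  rfl

end DivisorClassGroup

/-! A finite reflexive module over a noetherian ring is the kernel of a map `F → G` of finite free
modules. Over the principal ideal domain `D`, torsion-free modules are flat, so two such kernels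
tensor to the kernel of `F₁ ⊗ F₂ → (G₁ ⊗ F₂) × (F₁ ⊗ G₂)`, whose terms are finite free over `T = R₁
⊗[D] R₂`. A rank-one kernel of a map between reflexive modules is reflexive, so `𝔞₁ ⊗[D] 𝔞₂` is.
Replacing one factor by `R₁` or `R₂` covers the two extensions of scalars. The class formula follows
from `(T ⊗[R₁] 𝔞₁) ⊗[T] (T ⊗[R₂] 𝔞₂) ≅ 𝔞₁ ⊗[D] 𝔞₂`: the right side is already reflexive, so the
bidual in the definition of the sum does not change it. -/

/-! ### Reflexive modules as kernels. -/

section Reflexive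

variable {A : Type u} [CommRing A] {M : Type u} [AddCommGroup M] [Module A M]

/-- A module satisfying `IsRankOneAux` that is the kernel of a map between reflexive modules is
reflexive. -/
theorem IsRankOneAux.isReflexive_of_exact [IsDomain A] (h : IsRankOneAux A M)
    {F G : Type u} [AddCommGroup F] [Module A F] [AddCommGroup G] [Module A G]
    [Module.IsReflexive A F] [Module.IsReflexive A G] (i : M →ₗ[A] F) (d : F →ₗ[A] G)
    (hi : Function.Injective i) (hid : Function.Exact i d) : Module.IsReflexive A M := by
  have hM : Module.IsTorsionFree A M := hi.moduleIsTorsionFree i (by simp)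
  obtain ⟨g, m, h0, hg⟩ := h
  have hinj : Function.Injective g := by
    rw [injective_iff_map_eq_zero]
    intro z hz
    have := hg z
    rw [hz, zero_smul] at this
    exact (smul_eq_zero.mp this).resolve_left h0
  refine ⟨⟨fun x y hxy => hinj (by simpa using LinearMap.congr_fun hxy g), fun φ => ?_⟩⟩
  -- The functional `φ` is pushed along `i` into the bidual of `F`, where reflexivity represents it
  -- by some `x`; since `x` dies in `G`, it comes from `M`.
  obtain ⟨x, hx⟩ := (Module.bijective_dual_eval A F).2 (φ ∘ₗ i.dualMap)
  have hx' : ∀ k : Module.Dual A F, k x = φ (k ∘ₗ i) := fun k => LinearMap.congr_fun hx k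
  have hdx : d x = 0 := by
    refine (Module.bijective_dual_eval A G).1 (LinearMap.ext fun k => ?_)
    have hk : (k ∘ₗ d) ∘ₗ i = 0 := by
      ext z
      simp [hid.apply_apply_eq_zero]
    simpa [hk] using hx' (k ∘ₗ d)
  obtain ⟨z, rfl⟩ := (hid x).1 hdx
  have him : i m ≠ 0 := fun hm => h0 (by rw [hi (hm.trans (map_zero i).symm), map_zero])
  obtain ⟨k, hk⟩ : ∃ k : Module.Dual A F, k (i m) ≠ 0 := by
    by_contra! hc
    exact him ((Module.bijective_dual_eval A F).1 (LinearMap.ext fun f => by simp [hc f]))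
  refine ⟨z, LinearMap.ext fun f => mul_left_cancel₀ hk ?_⟩
  -- So far `z` represents `φ` only on functionals `k ∘ₗ i`. In rank one every `f` is proportional
  -- to a fixed nonzero one of these, and the factor `k (i m)` cancels.
  have key : k (i m) • f = f m • (k ∘ₗ i) := by
    ext w
    refine mul_left_cancel₀ h0 ?_
    have h1 := congrArg f (hg w)
    have h2 := congrArg (k ∘ₗ i) (hg w)
    simp only [map_smul, smul_eq_mul, LinearMap.comp_apply] at h1 h2
    simp only [LinearMap.smul_apply, LinearMap.comp_apply, smul_eq_mul]
    linear_combination k (i m) * h1 - f m * h2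
  have h1 := LinearMap.congr_fun key z
  have h2 := congrArg φ key
  rw [map_smul, map_smul, ← hx' k] at h2
  simp only [LinearMap.smul_apply, LinearMap.comp_apply, smul_eq_mul] at h1 h2
  rw [Module.Dual.eval_apply, h1, h2]

/-- A finite reflexive module over a noetherian ring is the kernel of a map between
finite free modules. -/
theorem Module.IsReflexive.exists_exact_free [IsNoetherianRing A] [Module.Finite A M]
    [Module.IsReflexive A M] :
    ∃ (F G : Type u) (_ : AddCommGroup F) (_ : Module A F) (_ : AddCommGroup G) (_ : Module A G)
      (i : M →ₗ[A] F) (d : F →ₗ[A] G), Module.Free A F ∧ Module.Finite A F ∧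
        Module.Free A G ∧ Module.Finite A G ∧ Function.Injective i ∧ Function.Exact i d := by
  -- A finite presentation of the dual, once dualized, starts with the bidual, which is `M`.
  obtain ⟨n, p, hp⟩ := Module.Finite.exists_fin' A (Module.Dual A M)
  obtain ⟨m, q, hq⟩ := Module.Finite.exists_fin' A (LinearMap.ker p)
  refine ⟨Module.Dual A (Fin n → A), Module.Dual A (Fin m → A), inferInstance, inferInstance,
    inferInstance, inferInstance, p.dualMap ∘ₗ Module.Dual.eval A M,
    ((LinearMap.ker p).subtype ∘ₗ q).dualMap, inferInstance, inferInstance, inferInstance,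
    inferInstance, ?_, fun x => ⟨fun hx => ?_, ?_⟩⟩
  · exact (LinearMap.dualMap_injective_of_surjective hp).comp (Module.bijective_dual_eval A M).1
  · have hx' : x ∈ LinearMap.range p.dualMap := by
      rw [LinearMap.range_dualMap_eq_dualAnnihilator_ker_of_surjective p hp,
        Submodule.mem_dualAnnihilator]
      intro w hw
      obtain ⟨v, hv⟩ := hq ⟨w, hw⟩
      simpa [hv] using LinearMap.congr_fun hx v
    obtain ⟨y, rfl⟩ := hx'
    obtain ⟨z, rfl⟩ := (Module.bijective_dual_eval A M).2 y
    exact ⟨z, rfl⟩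
  · rintro ⟨z, rfl⟩
    ext v
    simp

end Reflexive

section ExternalTensor

variable {D R₁ R₂ : Type u} [CommRing D] [CommRing R₁] [CommRing R₂] [Algebra D R₁] [Algebra D R₂]

/-! ### Linear maps between external tensor products. -/

section Map

variable {M₁ M₂ N₁ N₂ : Type u} [AddCommGroup M₁] [AddCommGroup M₂]
  [AddCommGroup N₁] [AddCommGroup N₂]
  [Module D M₁] [Module R₁ M₁] [IsScalarTower D R₁ M₁]
  [Module D M₂] [Module R₂ M₂] [IsScalarTower D R₂ M₂]
  [Module D N₁] [Module R₁ N₁] [IsScalarTower D R₁ N₁]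
  [Module D N₂] [Module R₂ N₂] [IsScalarTower D R₂ N₂]

/-- An additive map out of `M₁ ⊗[D] M₂` that commutes with the action of pure tensors on pure
tensors is `R₁ ⊗[D] R₂`-linear. -/
theorem map_externalTensor_smul {X : Type u} [AddCommMonoid X] [Module (R₁ ⊗[D] R₂) X]
    (f : M₁ ⊗[D] M₂ →+ X)
    (hf : ∀ (r : R₁) (s : R₂) (m : M₁) (n : M₂),
      f ((r • m) ⊗ₜ[D] (s • n)) = (r ⊗ₜ[D] s : R₁ ⊗[D] R₂) • f (m ⊗ₜ[D] n))
    (t : R₁ ⊗[D] R₂) (x : M₁ ⊗[D] M₂) : f (t • x) = t • f x := by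
  induction t with
  | zero => simp
  | add a b ha hb => rw [add_smul, map_add, ha, hb, add_smul]
  | tmul r s =>
    induction x with
    | zero => simp
    | add a b ha hb => rw [smul_add, map_add, ha, hb, map_add, smul_add]
    | tmul m n => rw [externalTensor_smul_tmul, hf]

/-- The tensor product of an `R₁`-linear and an `R₂`-linear map, as an `R₁ ⊗[D] R₂`-linear map. -/
noncomputable def externalTensorMap (f : M₁ →ₗ[R₁] N₁) (g : M₂ →ₗ[R₂] N₂) :
    M₁ ⊗[D] M₂ →ₗ[R₁ ⊗[D] R₂] N₁ ⊗[D] N₂ where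
  toFun := TensorProduct.map (f.restrictScalars D) (g.restrictScalars D)
  map_add' := map_add _
  map_smul' t x := map_externalTensor_smul
    (TensorProduct.map (f.restrictScalars D) (g.restrictScalars D)).toAddMonoidHom
    (fun r s m n => by simp [externalTensor_smul_tmul]) t x

theorem externalTensorMap_apply (f : M₁ →ₗ[R₁] N₁) (g : M₂ →ₗ[R₂] N₂) (x : M₁ ⊗[D] M₂) :
    (externalTensorMap f g : M₁ ⊗[D] M₂ →ₗ[R₁ ⊗[D] R₂] N₁ ⊗[D] N₂) x =
      TensorProduct.map (f.restrictScalars D) (g.restrictScalars D) x :=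
  rfl

end Map

/-! ### External tensor products and extension of scalars. -/

section Equiv

variable (M₁ M₂ : Type u) [AddCommGroup M₁] [AddCommGroup M₂]
  [Module D M₁] [Module R₁ M₁] [IsScalarTower D R₁ M₁]
  [Module D M₂] [Module R₂ M₂] [IsScalarTower D R₂ M₂]

/-- The `R₁`-action on the first factor of `M₁ ⊗[D] M₂` is the restriction of the action of
`R₁ ⊗[D] R₂`. -/
instance isScalarTower_externalTensor : IsScalarTower R₁ (R₁ ⊗[D] R₂) (M₁ ⊗[D] M₂) :=
  .of_algebraMap_smul fun r x => by
    induction x with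
    | zero => simp
    | add a b ha hb => rw [smul_add, ha, hb, smul_add]
    | tmul m n =>
      rw [Algebra.TensorProduct.algebraMap_apply, externalTensor_smul_tmul, one_smul,
        TensorProduct.smul_tmul']
      rfl

/-- The external tensor product is the tensor product of the two extensions of scalars. -/
theorem nonempty_externalTensor_equiv :
    Nonempty ((((R₁ ⊗[D] R₂) ⊗[R₁] M₁) ⊗[R₁ ⊗[D] R₂] ((R₁ ⊗[D] R₂) ⊗[R₂] M₂))
      ≃ₗ[R₁ ⊗[D] R₂] (M₁ ⊗[D] M₂)) := by
  let : Module R₂ (M₁ ⊗[D] M₂) :=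
    Module.compHom _ (algebraMap R₂ (R₁ ⊗[D] R₂))
  have : IsScalarTower R₂ (R₁ ⊗[D] R₂) (M₁ ⊗[D] M₂) := .of_algebraMap_smul fun _ _ => rfl
  have hsmul₂ (s : R₂) (m : M₁) (n : M₂) : s • (m ⊗ₜ[D] n) = m ⊗ₜ[D] (s • n) := by
    rw [← algebraMap_smul (R₁ ⊗[D] R₂) s (m ⊗ₜ[D] n : M₁ ⊗[D] M₂)]
    exact (externalTensor_smul_tmul 1 s m n).trans (by rw [one_smul])
  -- Extending scalars in one variable at a time gives `(t ⊗ m) ⊗ (t' ⊗ n) ↦ t t' (m ⊗ n)`; the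
  -- inverse `γ` inserts `1` for `t` and `t'`.
  let β (m : M₁) : (R₁ ⊗[D] R₂) ⊗[R₂] M₂ →ₗ[R₁ ⊗[D] R₂] M₁ ⊗[D] M₂ :=
    LinearMap.liftBaseChange (R₁ ⊗[D] R₂)
      { toFun := fun n => m ⊗ₜ[D] n
        map_add' := fun a b => TensorProduct.tmul_add m a b
        map_smul' := fun s n => (hsmul₂ s m n).symm }
  have hβ (m : M₁) (t : R₁ ⊗[D] R₂) (n : M₂) : β m (t ⊗ₜ[R₂] n) = t • (m ⊗ₜ[D] n) := rfl
  let α : (R₁ ⊗[D] R₂) ⊗[R₁] M₁ →ₗ[R₁ ⊗[D] R₂]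
      (R₁ ⊗[D] R₂) ⊗[R₂] M₂ →ₗ[R₁ ⊗[D] R₂] M₁ ⊗[D] M₂ :=
    LinearMap.liftBaseChange (R₁ ⊗[D] R₂)
      { toFun := β
        map_add' := fun a b => by
          ext n
          simp [hβ, TensorProduct.add_tmul]
        map_smul' := fun r a => by
          ext n
          simp [hβ, TensorProduct.smul_tmul'] }
  have hα (t t' : R₁ ⊗[D] R₂) (m : M₁) (n : M₂) :
      α (t ⊗ₜ[R₁] m) (t' ⊗ₜ[R₂] n) = t • t' • (m ⊗ₜ[D] n) := rfl
  have h₁ (r : R₁) (m : M₁) : (1 : R₁ ⊗[D] R₂) ⊗ₜ[R₁] (r • m) =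
      (r ⊗ₜ[D] (1 : R₂) : R₁ ⊗[D] R₂) • ((1 : R₁ ⊗[D] R₂) ⊗ₜ[R₁] m) := by
    rw [← TensorProduct.smul_tmul, Algebra.smul_def]; rfl
  have h₂ (s : R₂) (n : M₂) : (1 : R₁ ⊗[D] R₂) ⊗ₜ[R₂] (s • n) =
      ((1 : R₁) ⊗ₜ[D] s : R₁ ⊗[D] R₂) • ((1 : R₁ ⊗[D] R₂) ⊗ₜ[R₂] n) := by
    rw [← TensorProduct.smul_tmul, Algebra.smul_def]; rfl
  let γ : M₁ ⊗[D] M₂ →+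
      ((R₁ ⊗[D] R₂) ⊗[R₁] M₁) ⊗[R₁ ⊗[D] R₂] ((R₁ ⊗[D] R₂) ⊗[R₂] M₂) :=
    TensorProduct.liftAddHom
      { toFun := fun m =>
          { toFun := fun n => (1 ⊗ₜ[R₁] m) ⊗ₜ[R₁ ⊗[D] R₂] (1 ⊗ₜ[R₂] n)
            map_zero' := by simp
            map_add' := fun a b => by simp [TensorProduct.tmul_add] }
        map_zero' := by ext; simp
        map_add' := fun a b => by ext; simp [TensorProduct.tmul_add, TensorProduct.add_tmul] }
      (fun d m n => by
        have hd : algebraMap D R₁ d ⊗ₜ[D] (1 : R₂) = (1 : R₁) ⊗ₜ[D] algebraMap D R₂ d := by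
          rw [Algebra.algebraMap_eq_smul_one, Algebra.algebraMap_eq_smul_one,
            TensorProduct.smul_tmul]
        simp only [AddMonoidHom.coe_mk, ZeroHom.coe_mk]
        rw [← algebraMap_smul R₁ d m, ← algebraMap_smul R₂ d n, h₁, h₂, hd,
          TensorProduct.smul_tmul])
  have hγ (m : M₁) (n : M₂) :
      γ (m ⊗ₜ[D] n) = (1 ⊗ₜ[R₁] m) ⊗ₜ[R₁ ⊗[D] R₂] (1 ⊗ₜ[R₂] n) := rfl
  have hγs (t : R₁ ⊗[D] R₂) (x : M₁ ⊗[D] M₂) : γ (t • x) = t • γ x :=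
    map_externalTensor_smul γ (fun r s m n => by
      rw [hγ, hγ, h₁, h₂, TensorProduct.smul_tmul_smul, Algebra.TensorProduct.tmul_mul_tmul,
        mul_one, one_mul]) t x
  refine ⟨{ TensorProduct.lift α with
    invFun := γ
    left_inv := ?_
    right_inv := ?_ }⟩
  · intro x
    change γ (TensorProduct.lift α x) = x
    induction x with
    | zero => simp
    | add a b ha hb => rw [map_add, map_add, ha, hb]
    | tmul p q =>
      induction p with
      | zero => simp
      | add a b ha hb => rw [TensorProduct.add_tmul, map_add, map_add, ha, hb]
      | tmul t m =>
        induction q with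
        | zero => simp
        | add a b ha hb => rw [TensorProduct.tmul_add, map_add, map_add, ha, hb]
        | tmul t' n =>
          rw [TensorProduct.lift.tmul, hα, hγs, hγs, hγ]
          rw [smul_smul, ← TensorProduct.smul_tmul_smul, TensorProduct.smul_tmul',
            TensorProduct.smul_tmul', smul_eq_mul, smul_eq_mul, mul_one, mul_one]
  · intro x
    change TensorProduct.lift α (γ x) = x
    induction x with
    | zero => simp
    | add a b ha hb => rw [map_add, map_add, ha, hb]
    | tmul m n => rw [hγ, TensorProduct.lift.tmul, hα, one_smul, one_smul]

/-- The extension of scalars of an `R₁`-module to `R₁ ⊗[D] R₂` is its external tensor product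
with `R₂`. -/
theorem nonempty_externalTensor_self_right_equiv :
    Nonempty ((M₁ ⊗[D] R₂) ≃ₗ[R₁ ⊗[D] R₂] (R₁ ⊗[D] R₂) ⊗[R₁] M₁) := by
  obtain ⟨e⟩ := nonempty_externalTensor_equiv (D := D) (R₁ := R₁) (R₂ := R₂) M₁ R₂
  exact ⟨e.symm ≪≫ₗ
    TensorProduct.congr (.refl _ _) (TensorProduct.AlgebraTensorModule.rid R₂ (R₁ ⊗[D] R₂) _) ≪≫ₗ
    TensorProduct.rid _ _⟩

/-- The extension of scalars of an `R₂`-module to `R₁ ⊗[D] R₂` is its external tensor product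
with `R₁`. -/
theorem nonempty_externalTensor_self_left_equiv :
    Nonempty ((R₁ ⊗[D] M₂) ≃ₗ[R₁ ⊗[D] R₂] (R₁ ⊗[D] R₂) ⊗[R₂] M₂) := by
  obtain ⟨e⟩ := nonempty_externalTensor_equiv (D := D) (R₁ := R₁) (R₂ := R₂) R₁ M₂
  exact ⟨e.symm ≪≫ₗ
    TensorProduct.congr (TensorProduct.AlgebraTensorModule.rid R₁ (R₁ ⊗[D] R₂) _) (.refl _ _) ≪≫ₗ
    TensorProduct.lid _ _⟩

/-- External tensor products of finite free modules are reflexive. -/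
theorem isReflexive_externalTensor_of_free [Module.Free R₁ M₁] [Module.Finite R₁ M₁]
    [Module.Free R₂ M₂] [Module.Finite R₂ M₂] :
    Module.IsReflexive (R₁ ⊗[D] R₂) (M₁ ⊗[D] M₂) := by
  obtain ⟨e⟩ := nonempty_externalTensor_equiv (D := D) (R₁ := R₁) (R₂ := R₂) M₁ M₂
  have hfree : Module.Free (R₁ ⊗[D] R₂) (M₁ ⊗[D] M₂) := .of_equiv e
  have hfin : Module.Finite (R₁ ⊗[D] R₂) (M₁ ⊗[D] M₂) := .equiv e
  exact .of_finite_of_free _ _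

end Equiv

/-! ### Tensoring kernels over `D` by flatness. -/

section Exact

variable {M₁ M₂ F₁ F₂ G₁ G₂ : Type u} [AddCommGroup M₁] [AddCommGroup M₂]
  [AddCommGroup F₁] [AddCommGroup F₂] [AddCommGroup G₁] [AddCommGroup G₂]
  [Module D M₁] [Module R₁ M₁] [IsScalarTower D R₁ M₁]
  [Module D M₂] [Module R₂ M₂] [IsScalarTower D R₂ M₂]
  [Module D F₁] [Module R₁ F₁] [IsScalarTower D R₁ F₁]
  [Module D F₂] [Module R₂ F₂] [IsScalarTower D R₂ F₂]
  [Module D G₁] [Module R₁ G₁] [IsScalarTower D R₁ G₁]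
  [Module D G₂] [Module R₂ G₂] [IsScalarTower D R₂ G₂]

/-- The map factors as `M₁ ⊗ M₂ → M₁ ⊗ F₂ → F₁ ⊗ F₂`, and each step tensors an injection with a flat
module. -/
theorem externalTensorMap_injective [Module.Flat D M₁] [Module.Flat D F₂]
    {i₁ : M₁ →ₗ[R₁] F₁} {i₂ : M₂ →ₗ[R₂] F₂}
    (h₁ : Function.Injective i₁) (h₂ : Function.Injective i₂) :
    Function.Injective
      (externalTensorMap i₁ i₂ : M₁ ⊗[D] M₂ →ₗ[R₁ ⊗[D] R₂] F₁ ⊗[D] F₂) := by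
  have h₁' : Function.Injective ((i₁.restrictScalars D).rTensor F₂) :=
    Module.Flat.rTensor_preserves_injective_linearMap _ h₁
  have h₂' : Function.Injective ((i₂.restrictScalars D).lTensor M₁) :=
    Module.Flat.lTensor_preserves_injective_linearMap _ h₂
  intro x y hxy
  rw [externalTensorMap_apply, externalTensorMap_apply, ← LinearMap.rTensor_comp_lTensor] at hxy
  exact h₂' (h₁' hxy)

/-- External tensor products of kernels between flat modules are kernels. -/
theorem externalTensorMap_exact [Module.Flat D M₂] [Module.Flat D F₁] [Module.Flat D F₂]
    [Module.Flat D G₁] {i₁ : M₁ →ₗ[R₁] F₁} {d₁ : F₁ →ₗ[R₁] G₁} {i₂ : M₂ →ₗ[R₂] F₂}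
    {d₂ : F₂ →ₗ[R₂] G₂} (h₂ : Function.Injective i₂)
    (e₁ : Function.Exact i₁ d₁) (e₂ : Function.Exact i₂ d₂) :
    Function.Exact
      (externalTensorMap i₁ i₂ : M₁ ⊗[D] M₂ →ₗ[R₁ ⊗[D] R₂] F₁ ⊗[D] F₂)
      ((externalTensorMap d₁ .id : F₁ ⊗[D] F₂ →ₗ[R₁ ⊗[D] R₂] G₁ ⊗[D] F₂).prod
        (externalTensorMap .id d₂ : F₁ ⊗[D] F₂ →ₗ[R₁ ⊗[D] R₂] F₁ ⊗[D] G₂)) := by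
  intro x
  have E₁ : Function.Exact ((i₁.restrictScalars D).rTensor M₂)
      ((d₁.restrictScalars D).rTensor M₂) := Module.Flat.rTensor_exact M₂ e₁
  have E₂ : Function.Exact ((i₂.restrictScalars D).lTensor F₁)
      ((d₂.restrictScalars D).lTensor F₁) := Module.Flat.lTensor_exact F₁ e₂
  constructor
  · intro hx
    rw [LinearMap.prod_apply, Function.prod_apply, Prod.mk_eq_zero] at hx
    obtain ⟨y, rfl⟩ := (E₂ x).1 hx.2
    -- The equation holds after mapping to `G₁ ⊗ F₂`, and `G₁ ⊗ M₂` embeds there because `G₁` is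
    -- flat.
    have hy : (d₁.restrictScalars D).rTensor M₂ y = 0 := by
      refine Module.Flat.lTensor_preserves_injective_linearMap (M := G₁)
        (i₂.restrictScalars D) h₂ ?_
      rw [map_zero, ← LinearMap.comp_apply, LinearMap.lTensor_comp_rTensor,
        ← LinearMap.rTensor_comp_lTensor]
      exact hx.1
    obtain ⟨z, rfl⟩ := (E₁ y).1 hy
    refine ⟨z, ?_⟩
    rw [← LinearMap.comp_apply, LinearMap.lTensor_comp_rTensor]
    rfl
  · rintro ⟨z, rfl⟩
    induction z with
    | zero => simp
    | add a b ha hb => rw [map_add, map_add, ha, hb, add_zero]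
    | tmul m n => simp [externalTensorMap_apply, e₁.apply_apply_eq_zero, e₂.apply_apply_eq_zero]

end Exact

/-! ### Rank one and reflexivity of external tensor products. -/

section RankOne

variable {M₁ M₂ : Type u} [AddCommGroup M₁] [AddCommGroup M₂]
  [Module D M₁] [Module R₁ M₁] [IsScalarTower D R₁ M₁]
  [Module D M₂] [Module R₂ M₂] [IsScalarTower D R₂ M₂]

theorem IsRankOneAux.externalTensor [IsDomain (R₁ ⊗[D] R₂)]
    (hf₁ : Function.Injective (algebraMap D R₁)) (hf₂ : Function.Injective (algebraMap D R₂))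
    [Module.Flat D R₁] [Module.Flat D R₂] (h₁ : IsRankOneAux R₁ M₁) (h₂ : IsRankOneAux R₂ M₂) :
    IsRankOneAux (R₁ ⊗[D] R₂) (M₁ ⊗[D] M₂) := by
  obtain ⟨g₁, m₁, h₁, hg₁⟩ := h₁
  obtain ⟨g₂, m₂, h₂, hg₂⟩ := h₂
  let g : M₁ ⊗[D] M₂ →ₗ[R₁ ⊗[D] R₂] R₁ ⊗[D] R₂ :=
    { toFun := TensorProduct.map (g₁.restrictScalars D) (g₂.restrictScalars D)
      map_add' := map_add _
      map_smul' := map_externalTensor_smul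
        (TensorProduct.map (g₁.restrictScalars D) (g₂.restrictScalars D)).toAddMonoidHom
        (fun r s m n => by simp) }
  have hg (m : M₁) (n : M₂) : g (m ⊗ₜ n) = g₁ m ⊗ₜ g₂ n := rfl
  refine ⟨g, m₁ ⊗ₜ m₂, ?_, fun z => ?_⟩
  -- A pure tensor of nonzero elements is a product of their images in a domain into which flatness
  -- embeds both rings.
  · have : g₁ m₁ ⊗ₜ[D] g₂ m₂ = (g₁ m₁ ⊗ₜ[D] (1 : R₂)) * ((1 : R₁) ⊗ₜ[D] g₂ m₂) := by simp
    rw [hg, this]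
    refine mul_ne_zero (fun h => h₁ ?_) (fun h => h₂ ?_)
    · exact Algebra.TensorProduct.includeLeft_injective (S := D) hf₂ (by simpa using h)
    · exact Algebra.TensorProduct.includeRight_injective hf₁ (by simpa using h)
  · induction z with
    | zero => simp
    | add x y hx hy => rw [smul_add, hx, hy, map_add, add_smul]
    | tmul x y =>
      rw [hg, hg, externalTensor_smul_tmul, externalTensor_smul_tmul, hg₁, hg₂]

/-- Over a principal ideal domain, external tensor products of finite reflexive modules of rank
one are finite reflexive of rank one. -/
theorem IsRankOneReflexive.externalTensor [IsDomain D] [IsPrincipalIdealRing D]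
    [IsDomain R₁] [IsNoetherianRing R₁] [IsDomain R₂] [IsNoetherianRing R₂]
    [IsDomain (R₁ ⊗[D] R₂)] [IsNoetherianRing (R₁ ⊗[D] R₂)]
    (hf₁ : Function.Injective (algebraMap D R₁)) (hf₂ : Function.Injective (algebraMap D R₂))
    (h₁ : IsRankOneReflexive R₁ M₁) (h₂ : IsRankOneReflexive R₂ M₂) :
    IsRankOneReflexive (R₁ ⊗[D] R₂) (M₁ ⊗[D] M₂) := by
  have : FaithfulSMul D R₁ := (faithfulSMul_iff_algebraMap_injective D R₁).2 hf₁
  have : FaithfulSMul D R₂ := (faithfulSMul_iff_algebraMap_injective D R₂).2 hf₂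
  have := h₁.finite
  have := h₁.reflexive
  have := h₂.finite
  have := h₂.reflexive
  obtain ⟨F₁, G₁, _, _, _, _, i₁, d₁, _, _, _, _, hi₁, e₁⟩ :=
    Module.IsReflexive.exists_exact_free (A := R₁) (M := M₁)
  obtain ⟨F₂, G₂, _, _, _, _, i₂, d₂, _, _, _, _, hi₂, e₂⟩ :=
    Module.IsReflexive.exists_exact_free (A := R₂) (M := M₂)
  let : Module D F₁ := Module.compHom F₁ (algebraMap D R₁)
  let : Module D G₁ := Module.compHom G₁ (algebraMap D R₁)
  let : Module D F₂ := Module.compHom F₂ (algebraMap D R₂)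
  let : Module D G₂ := Module.compHom G₂ (algebraMap D R₂)
  have : IsScalarTower D R₁ F₁ := .of_algebraMap_smul fun _ _ => rfl
  have : IsScalarTower D R₁ G₁ := .of_algebraMap_smul fun _ _ => rfl
  have : IsScalarTower D R₂ F₂ := .of_algebraMap_smul fun _ _ => rfl
  have : IsScalarTower D R₂ G₂ := .of_algebraMap_smul fun _ _ => rfl
  -- Torsion-freeness passes from `R₁` and `R₂` down to `D`, where it gives the flatness that the
  -- exactness lemmas need.
  have : Module.IsTorsionFree D M₁ := .trans_faithfulSMul D R₁ M₁
  have : Module.IsTorsionFree D F₁ := .trans_faithfulSMul D R₁ F₁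
  have : Module.IsTorsionFree D G₁ := .trans_faithfulSMul D R₁ G₁
  have : Module.IsTorsionFree D M₂ := .trans_faithfulSMul D R₂ M₂
  have : Module.IsTorsionFree D F₂ := .trans_faithfulSMul D R₂ F₂
  have : Module.IsTorsionFree D R₁ := .trans_faithfulSMul D R₁ R₁
  have : Module.IsTorsionFree D R₂ := .trans_faithfulSMul D R₂ R₂
  have := isReflexive_externalTensor_of_free (D := D) (R₁ := R₁) (R₂ := R₂) F₁ F₂
  have := isReflexive_externalTensor_of_free (D := D) (R₁ := R₁) (R₂ := R₂) G₁ F₂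
  have := isReflexive_externalTensor_of_free (D := D) (R₁ := R₁) (R₂ := R₂) F₁ G₂
  have haux : IsRankOneAux (R₁ ⊗[D] R₂) (M₁ ⊗[D] M₂) := h₁.aux.externalTensor hf₁ hf₂ h₂.aux
  have := haux.isReflexive_of_exact _ _ (externalTensorMap_injective hi₁ hi₂)
    (externalTensorMap_exact hi₂ e₁ e₂)
  exact haux.isRankOneReflexive

end RankOne

end ExternalTensor

theorem IsRankOneReflexive.of_equiv {A : Type u} [CommRing A] {M N : Type u} [AddCommGroup M]
    [Module A M] [AddCommGroup N] [Module A N] (h : IsRankOneReflexive A M) (e : M ≃ₗ[A] N) :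
    IsRankOneReflexive A N where
  finite := have := h.finite; .equiv e
  reflexive := have := h.reflexive; Module.equiv e
  rank_eq_one := e.rank_eq.symm.trans h.rank_eq_one

theorem isRankOneReflexive_self (A : Type u) [CommRing A] [IsDomain A] : IsRankOneReflexive A A :=
  ⟨inferInstance, inferInstance, Module.rank_self A⟩

theorem lemma4p3
    {D R₁ R₂ : Type u} [CommRing D] [IsDomain D] [IsPrincipalIdealRing D]
    [CommRing R₁] [IsDomain R₁] [IsNoetherianRing R₁] [IsIntegrallyClosed R₁]
    [CommRing R₂] [IsDomain R₂] [IsNoetherianRing R₂] [IsIntegrallyClosed R₂]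
    [Algebra D R₁] [Algebra D R₂]
    (hf₁ : Function.Injective (algebraMap D R₁)) (hf₂ : Function.Injective (algebraMap D R₂))
    [IsDomain (R₁ ⊗[D] R₂)] [IsNoetherianRing (R₁ ⊗[D] R₂)] [IsIntegrallyClosed (R₁ ⊗[D] R₂)]
    (𝔞₁ 𝔞₂ : Type u) [AddCommGroup 𝔞₁] [AddCommGroup 𝔞₂]
    [Module R₁ 𝔞₁] [Module D 𝔞₁] [IsScalarTower D R₁ 𝔞₁]
    [Module R₂ 𝔞₂] [Module D 𝔞₂] [IsScalarTower D R₂ 𝔞₂]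
    (h𝔞₁ : IsRankOneReflexive R₁ 𝔞₁) (h𝔞₂ : IsRankOneReflexive R₂ 𝔞₂)
    (h : IsField D ∨ (IsSemidualizing R₁ 𝔞₁ ∧ IsSemidualizing R₂ 𝔞₂)) :
    Module.IsReflexive (R₁ ⊗[D] R₂) (𝔞₁ ⊗[D] 𝔞₂) ∧
    ∃ (h₁₂ : IsRankOneReflexive (R₁ ⊗[D] R₂) (𝔞₁ ⊗[D] 𝔞₂))
      (h₁ : IsRankOneReflexive (R₁ ⊗[D] R₂) ((R₁ ⊗[D] R₂) ⊗[R₁] 𝔞₁))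
      (h₂ : IsRankOneReflexive (R₁ ⊗[D] R₂) ((R₁ ⊗[D] R₂) ⊗[R₂] 𝔞₂)),
      DivisorClassGroup.mk (𝔞₁ ⊗[D] 𝔞₂) h₁₂ =
        DivisorClassGroup.mk ((R₁ ⊗[D] R₂) ⊗[R₁] 𝔞₁) h₁ +
          DivisorClassGroup.mk ((R₁ ⊗[D] R₂) ⊗[R₂] 𝔞₂) h₂ := by
  have h₁₂ := h𝔞₁.externalTensor hf₁ hf₂ h𝔞₂
  obtain ⟨e₁⟩ := nonempty_externalTensor_self_right_equiv (D := D) (R₁ := R₁) (R₂ := R₂) 𝔞₁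
  obtain ⟨e₂⟩ := nonempty_externalTensor_self_left_equiv (D := D) (R₁ := R₁) (R₂ := R₂) 𝔞₂
  obtain ⟨e⟩ := nonempty_externalTensor_equiv (D := D) (R₁ := R₁) (R₂ := R₂) 𝔞₁ 𝔞₂
  have := h₁₂.reflexive
  refine ⟨h₁₂.reflexive, h₁₂,
    (h𝔞₁.externalTensor hf₁ hf₂ (isRankOneReflexive_self R₂)).of_equiv e₁,
    ((isRankOneReflexive_self R₁).externalTensor hf₁ hf₂ h𝔞₂).of_equiv e₂, ?_⟩
  rw [DivisorClassGroup.mk_add_mk, DivisorClassGroup.mk_eq_mk_iff]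
  -- Evaluation identifies the reflexive module with its bidual, and the bidual of `e` carries this
  -- to the one defining the sum.
  exact ⟨Module.evalEquiv (R₁ ⊗[D] R₂) (𝔞₁ ⊗[D] 𝔞₂) ≪≫ₗ e.dualMap.symm.dualMap⟩
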